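/- Let $G$ be a Bayesian network on a finite set $V$ of binary variables: a directed acyclic graph on $V$ with parent sets $\operatorname{pa}(v)$ and conditional probability tables $P(X_v=b\mid X_{\operatorname{pa}(v)}=y)$, $b\in\{0,1\}$, $y\in\{0,1\}^{\operatorname{pa}(v)}$, defining the distribution $D(x)=\prod_{v\in V}P(x_v\mid x_{\operatorname{pa}(v)})$ on $\{0,1\}^V$. Let $\mu_{v,y}$ and $\sigma_{v,y}$ be the mean and the standard deviation of $X_v$ given $X_{\operatorname{pa}(v)}=y$. Assume that - $G$ is a forest, i.e. every node has at most one parent (in particular, $G$ may be a tree); - $G$ is $c$-bounded for some $c\in(0,1)$: $c\le P(X_v=b\mid X_{\operatorname{pa}(v)}=y)\le 1-c$ for all $v$, $b$, $y$; - $G$ is $\alpha$-difference-bounded for some $\alpha<\tfrac12$: $|\mu_{v,y}-\mu_{v,y'}|\le\alpha$ and $|\sigma_{v,y}-\sigma_{v,y'}|\le\alpha$ for all $v$ and all $y,y'\in\{0,1\}^{\operatorname{pa}(v)}$. For $S\subseteq V$ put $\phi_S(x)=\prod_{v\in S}\frac{x_v-\mu_{v,x_{\operatorname{pa}(v)}}}{\sigma_{v,x_{\operatorname{pa}(v)}}}$,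 and for $f:\{0,1\}^V\to\mathbb R$ let $\hat f_S=\mathbb E_{X\sim D}[f(X)\phi_S(X)]$ and $L_1(f)=\sum_{S\subseteq V}|\hat f_S|$. Then for all disjoint $T_1,T_0\subseteq V$ with $|T_1|+|T_0|=d$, the $\{0,1\}$-valued conjunction of $d$ literals $f(x)=\bigwedge_{i\in T_1}x_i\wedge\bigwedge_{j\in T_0}\bar x_j$ satisfies $$L_1(f)\le\left(\frac{2-2\alpha}{1-2\alpha}\right)^{2d}.$$ -/

import Mathlib

/-- A Bayesian network over binary variables `X_v`, `v ∈ V`: a directed acyclic graph, given by the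
parent sets, together with a conditional probability table for every node;
`cpt v y b` is `P(X_v = b | X_{pa(v)} = y)`. -/
structure BayesNet (V : Type*) where
  /-- the parents of a node -/
  pa : V → Finset V
  acyclic : ∀ v, ¬ Relation.TransGen (fun u w => u ∈ pa w) v v
  /-- the conditional probability tables -/
  cpt : ∀ v : V, (pa v → Bool) → Bool → ℝ
  cpt_nonneg : ∀ v y b, 0 ≤ cpt v y b
  cpt_sum : ∀ v y, ∑ b, cpt v y b = 1

namespace BayesNet

/-- A bit as a real number. -/
def bit (b : Bool) : ℝ := if b then 1 else 0

variable {V : Type*}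

/-- The restriction `x_{pa(v)}` of an assignment to the parents of `v`. -/
def restrict (G : BayesNet V) (v : V) (x : V → Bool) : G.pa v → Bool := fun u => x u

/-- The conditional expectation `μ_{v,y}` of `X_v` given `X_{pa(v)} = y`. -/
def mean (G : BayesNet V) (v : V) (y : G.pa v → Bool) : ℝ :=
  ∑ b, G.cpt v y b * bit b

/-- The conditional standard deviation `σ_{v,y}` of `X_v` given `X_{pa(v)} = y`. -/
noncomputable def std (G : BayesNet V) (v : V) (y : G.pa v → Bool) : ℝ :=
  Real.sqrt (∑ b, G.cpt v y b * (bit b - G.mean v y) ^ 2)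

/-- All entries of the conditional probability tables lie in `[c, 1 - c]`. -/
def IsBounded (G : BayesNet V) (c : ℝ) : Prop :=
  ∀ v y b, c ≤ G.cpt v y b ∧ G.cpt v y b ≤ 1 - c

/-- The parents' values change the conditional mean and the conditional standard deviation of any
node by at most `α`. -/
def IsDifferenceBounded (G : BayesNet V) (α : ℝ) : Prop :=
  ∀ v y z, |G.mean v y - G.mean v z| ≤ α ∧ |G.std v y - G.std v z| ≤ α

/-- Every node has at most one parent. Together with acyclicity: the graph is a forest of rooted
trees with edges directed away from the roots; a tree is the case of a single root. -/
def IsForest (G : BayesNet V) : Prop := ∀ v, (G.pa v).card ≤ 1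

/-- The basis function `φ_S(x) = ∏_{v ∈ S} (x_v - μ_{v,x_{pa(v)}}) / σ_{v,x_{pa(v)}}`. -/
noncomputable def basis (G : BayesNet V) (S : Finset V) (x : V → Bool) : ℝ :=
  ∏ v ∈ S, (bit (x v) - G.mean v (G.restrict v x)) / G.std v (G.restrict v x)

variable [Fintype V]

/-- The joint distribution `P(x) = ∏_v P(x_v | x_{pa(v)})`. -/
def prob (G : BayesNet V) (x : V → Bool) : ℝ := ∏ v, G.cpt v (G.restrict v x) (x v)

variable [DecidableEq V]

/-- The expectation of `f(X)` under the joint distribution. -/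
def expect (G : BayesNet V) (f : (V → Bool) → ℝ) : ℝ := ∑ x, G.prob x * f x

/-- The Fourier coefficient `E[f(X) φ_S(X)]`. -/
noncomputable def fourierCoeff (G : BayesNet V) (f : (V → Bool) → ℝ) (S : Finset V) : ℝ :=
  G.expect fun x => f x * G.basis S x

/-- The spectral norm `∑_S |f̂_S|`. -/
noncomputable def spectralNorm (G : BayesNet V) (f : (V → Bool) → ℝ) : ℝ :=
  ∑ S : Finset V, |G.fourierCoeff f S|

end BayesNet

/-- The `{0,1}`-valued conjunction of the literals `x_i`, `i ∈ T₁`, and `¬ x_j`, `j ∈ T₀`. -/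
def conjunction {V : Type*} (T₁ T₀ : Finset V) (x : V → Bool) : ℝ :=
  if (∀ i ∈ T₁, x i = true) ∧ (∀ j ∈ T₀, x j = false) then 1 else 0

/-! A conjunction is a product of one-bit functions `h v`, and the spectral norm of any such product
is at most `∏ v, bitNorm t (h v)`. To see this, integrate out a childless node `i`. Coefficients at
sets without `i` acquire the factor `condMean`, those at sets with `i` the factor `condCoeff`. In a
forest both depend on at most one bit, that of the parent, and are absorbed into its factor, at a
cost controlled by submultiplicativity (`bitNorm_mul_le`). The two norms add up to at most `bitNorm
t (h i)` when `1/2 + 2αt = t`, so the bound is inherited. A literal has norm `1 + t` and the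
constant `1` has norm `1`, giving `(1 + t) ^ d`. -/

/-- A submultiplicative norm on functions of one bit: the sup norm plus `t` times the variation. -/
noncomputable def bitNorm (t : ℝ) (h : Bool → ℝ) : ℝ :=
  max |h false| |h true| + t * |h true - h false|

lemma abs_le_max_bit (h : Bool → ℝ) (b : Bool) : |h b| ≤ max |h false| |h true| := by
  cases b <;> simp

lemma bitNorm_nonneg {t : ℝ} (ht : 0 ≤ t) (h : Bool → ℝ) : 0 ≤ bitNorm t h := by
  unfold bitNorm
  positivity

/-- The discrete Leibniz rule bounds the variation of the product; expanding the right side leaves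
the product of the two variation terms as slack. -/
lemma bitNorm_mul_le {t : ℝ} (ht : 0 ≤ t) (h k : Bool → ℝ) :
    bitNorm t (fun b => h b * k b) ≤ bitNorm t h * bitNorm t k := by
  unfold bitNorm
  set M := max |h false| |h true|
  set N := max |k false| |k true|
  have hM : ∀ b, |h b| ≤ M := abs_le_max_bit h
  have hN : ∀ b, |k b| ≤ N := abs_le_max_bit k
  have hM0 : 0 ≤ M := (abs_nonneg _).trans (hM true)
  have h1 : ∀ b, |h b * k b| ≤ M * N := fun b => by
    rw [abs_mul]
    exact mul_le_mul (hM b) (hN b) (abs_nonneg _) hM0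
  have h2 : |h true * k true - h false * k false|
      ≤ M * |k true - k false| + |h true - h false| * N := by
    have e : h true * k true - h false * k false
        = h true * (k true - k false) + (h true - h false) * k false := by ring
    rw [e]
    refine (abs_add_le _ _).trans ?_
    rw [abs_mul, abs_mul]
    exact add_le_add (mul_le_mul_of_nonneg_right (hM _) (abs_nonneg _))
      (mul_le_mul_of_nonneg_left (hN _) (abs_nonneg _))
  have h3 := mul_le_mul_of_nonneg_left h2 ht
  have h4 : 0 ≤ (t * |h true - h false|) * (t * |k true - k false|) := by positivity
  have h5 := max_le (h1 false) (h1 true)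
  linarith

/-- Averaging over one coordinate: resampling the bit `x i` covers every assignment twice. -/
lemma sum_sum_update_bool {V : Type*} [Fintype V] [DecidableEq V] (i : V)
    (F : (V → Bool) → ℝ) :
    ∑ x, ∑ b, F (Function.update x i b) = 2 * ∑ x, F x := by
  have hinv : Function.Involutive (fun x : V → Bool => Function.update x i (!x i)) := by
    intro x
    simp
  have hpt : ∀ x : V → Bool,
      ∑ b, F (Function.update x i b) = F x + F (Function.update x i (!x i)) := by
    intro x
    have hx : F (Function.update x i (x i)) = F x := by rw [Function.update_eq_self]
    rw [← hx, Fintype.sum_bool]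
    cases x i <;> simp [add_comm]
  have hflip : ∑ x : V → Bool, F (Function.update x i (!x i)) = ∑ x, F x :=
    Equiv.sum_comp hinv.toPerm F
  simp_rw [hpt]
  rw [Finset.sum_add_distrib, hflip, two_mul]

/-! ### Graph structure and conditional moments -/

namespace BayesNet

variable {V : Type*}

lemma notMem_pa_self (G : BayesNet V) (i : V) : i ∉ G.pa i := fun h =>
  G.acyclic i (Relation.TransGen.single h)

lemma exists_childless [Finite V] (G : BayesNet V) {U : Finset V} (hU : U.Nonempty) :
    ∃ i ∈ U, ∀ v ∈ U, i ∉ G.pa v := by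
  let r : V → V → Prop := fun a b => Relation.TransGen (fun u w => u ∈ G.pa w) b a
  have : IsTrans V r := ⟨fun _ _ _ h₁ h₂ => Relation.TransGen.trans h₂ h₁⟩
  have : Std.Irrefl r := ⟨G.acyclic⟩
  have hwf : WellFounded r := Finite.wellFounded_of_trans_of_irrefl r
  obtain ⟨i, hi, hmin⟩ := hwf.has_min (U : Set V) hU
  exact ⟨i, hi, fun v hv h => hmin v hv (Relation.TransGen.single h)⟩

lemma restrict_update_of_notMem [DecidableEq V] (G : BayesNet V) {i v : V} (h : i ∉ G.pa v)
    (x : V → Bool) (b : Bool) : G.restrict v (Function.update x i b) = G.restrict v x := by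
  funext u
  have : (u : V) ≠ i := fun e => h (e ▸ u.2)
  simp [restrict, this]

lemma basis_update_of_notMem [DecidableEq V] (G : BayesNet V) {i : V} {S : Finset V}
    (hiS : i ∉ S) (hS : ∀ v ∈ S, i ∉ G.pa v) (x : V → Bool) (b : Bool) :
    G.basis S (Function.update x i b) = G.basis S x := by
  refine Finset.prod_congr rfl fun v hv => ?_
  have : v ≠ i := fun e => hiS (e ▸ hv)
  rw [G.restrict_update_of_notMem (hS v hv), Function.update_of_ne this]

lemma cpt_false (G : BayesNet V) (v : V) (y : G.pa v → Bool) :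
    G.cpt v y false = 1 - G.cpt v y true := by
  have := G.cpt_sum v y
  rw [Fintype.sum_bool] at this
  linarith

lemma mean_eq (G : BayesNet V) (v : V) (y : G.pa v → Bool) : G.mean v y = G.cpt v y true := by
  simp [mean, bit]

lemma std_eq (G : BayesNet V) (v : V) (y : G.pa v → Bool) :
    G.std v y = √(G.cpt v y true * (1 - G.cpt v y true)) := by
  unfold std
  congr 1
  rw [Fintype.sum_bool, mean_eq, cpt_false]
  simp only [bit, if_true, Bool.false_eq_true, if_false]
  ring

lemma std_nonneg (G : BayesNet V) (v : V) (y : G.pa v → Bool) : 0 ≤ G.std v y :=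
  Real.sqrt_nonneg _

lemma std_le_half (G : BayesNet V) (v : V) (y : G.pa v → Bool) : G.std v y ≤ 1 / 2 := by
  rw [std_eq, Real.sqrt_le_left (by norm_num)]
  nlinarith [sq_nonneg (G.cpt v y true - 1 / 2)]

/-- The conditional expectation `E[h(X_v) | X_{pa(v)} = y]`. -/
def condMean (G : BayesNet V) (v : V) (h : Bool → ℝ) (y : G.pa v → Bool) : ℝ :=
  ∑ b, G.cpt v y b * h b

/-- The conditional Fourier coefficient `E[h(X_v) φ_v(X) | X_{pa(v)} = y]`. -/
noncomputable def condCoeff (G : BayesNet V) (v : V) (h : Bool → ℝ) (y : G.pa v → Bool) : ℝ :=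
  ∑ b, G.cpt v y b * (h b * ((bit b - G.mean v y) / G.std v y))

lemma condMean_eq (G : BayesNet V) (v : V) (h : Bool → ℝ) (y : G.pa v → Bool) :
    G.condMean v h y = h false + G.mean v y * (h true - h false) := by
  rw [condMean, Fintype.sum_bool, cpt_false, mean_eq]
  ring

lemma condCoeff_eq (G : BayesNet V) (v : V) (h : Bool → ℝ) (y : G.pa v → Bool) :
    G.condCoeff v h y = G.std v y * (h true - h false) := by
  have h0 := G.cpt_nonneg v y true
  have h1 := G.cpt_nonneg v y false
  rw [cpt_false] at h1
  have hs : G.std v y * G.std v y = G.cpt v y true * (1 - G.cpt v y true) := by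
    rw [std_eq]
    exact Real.mul_self_sqrt (mul_nonneg h0 h1)
  rw [condCoeff, Fintype.sum_bool, cpt_false, mean_eq]
  simp only [bit, if_true, Bool.false_eq_true, if_false]
  have e : G.cpt v y true * (h true * ((1 - G.cpt v y true) / G.std v y)) +
      (1 - G.cpt v y true) * (h false * ((0 - G.cpt v y true) / G.std v y))
      = (G.cpt v y true * (1 - G.cpt v y true)) / G.std v y * (h true - h false) := by ring
  -- `σ * σ / σ = σ` also holds at `σ = 0`, where division yields `0`.
  rw [e, ← hs, mul_self_div_self]

lemma abs_condMean_le (G : BayesNet V) (v : V) (h : Bool → ℝ) (y : G.pa v → Bool) :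
    |G.condMean v h y| ≤ max |h false| |h true| := by
  calc |G.condMean v h y| ≤ ∑ b, |G.cpt v y b * h b| := Finset.abs_sum_le_sum_abs _ _
    _ ≤ ∑ b, G.cpt v y b * max |h false| |h true| := by
        refine Finset.sum_le_sum fun b _ => ?_
        rw [abs_mul, abs_of_nonneg (G.cpt_nonneg v y b)]
        exact mul_le_mul_of_nonneg_left (abs_le_max_bit h b) (G.cpt_nonneg v y b)
    _ = max |h false| |h true| := by rw [← Finset.sum_mul, G.cpt_sum, one_mul]

lemma abs_condCoeff_le (G : BayesNet V) (v : V) (h : Bool → ℝ) (y : G.pa v → Bool) :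
    |G.condCoeff v h y| ≤ 1 / 2 * |h true - h false| := by
  rw [condCoeff_eq, abs_mul, abs_of_nonneg (G.std_nonneg v y)]
  exact mul_le_mul_of_nonneg_right (G.std_le_half v y) (abs_nonneg _)

lemma abs_condMean_sub_le (G : BayesNet V) {α : ℝ} (hα : G.IsDifferenceBounded α) (v : V)
    (h : Bool → ℝ) (y z : G.pa v → Bool) :
    |G.condMean v h y - G.condMean v h z| ≤ α * |h true - h false| := by
  rw [condMean_eq, condMean_eq, add_sub_add_left_eq_sub, ← sub_mul, abs_mul]
  exact mul_le_mul_of_nonneg_right (hα v y z).1 (abs_nonneg _)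

lemma abs_condCoeff_sub_le (G : BayesNet V) {α : ℝ} (hα : G.IsDifferenceBounded α) (v : V)
    (h : Bool → ℝ) (y z : G.pa v → Bool) :
    |G.condCoeff v h y - G.condCoeff v h z| ≤ α * |h true - h false| := by
  rw [condCoeff_eq, condCoeff_eq, ← sub_mul, abs_mul]
  exact mul_le_mul_of_nonneg_right (hα v y z).2 (abs_nonneg _)

/-- With `Δ = |h true - h false|`, the mean contributes `max |h| + tαΔ` and the coefficient `Δ/2 +
tαΔ`, where `1/2` bounds `σ`. The equation for `t` makes the total exactly `max |h| + tΔ`. -/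
lemma bitNorm_condMean_add_bitNorm_condCoeff_le (G : BayesNet V) {α t : ℝ}
    (hα : G.IsDifferenceBounded α) (ht : 0 ≤ t) (htα : 1 / 2 + 2 * α * t = t)
    (v : V) (h : Bool → ℝ) :
    bitNorm t (fun b => G.condMean v h fun _ => b) +
      bitNorm t (fun b => G.condCoeff v h fun _ => b) ≤ bitNorm t h := by
  unfold bitNorm
  have hA := max_le (G.abs_condMean_le v h fun _ => false) (G.abs_condMean_le v h fun _ => true)
  have hB := max_le (G.abs_condCoeff_le v h fun _ => false) (G.abs_condCoeff_le v h fun _ => true)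
  have hA' := mul_le_mul_of_nonneg_left
    (G.abs_condMean_sub_le hα v h (fun _ => true) (fun _ => false)) ht
  have hB' := mul_le_mul_of_nonneg_left
    (G.abs_condCoeff_sub_le hα v h (fun _ => true) (fun _ => false)) ht
  have e : t * |h true - h false| = (1 / 2 + 2 * α * t) * |h true - h false| := by rw [htα]
  rw [e]
  linarith

variable [Fintype V] [DecidableEq V]

/-! ### Integrating out childless nodes -/

/-- The expectation under the distribution in which the nodes of `U` follow their conditional
probability tables and all other nodes are uniform and independent. -/
noncomputable def partialExpect (G : BayesNet V) (U : Finset V) (f : (V → Bool) → ℝ) : ℝ :=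
  (2 ^ (Uᶜ).card)⁻¹ * ∑ x, (∏ v ∈ U, G.cpt v (G.restrict v x) (x v)) * f x

lemma partialExpect_univ (G : BayesNet V) (f : (V → Bool) → ℝ) :
    G.partialExpect Finset.univ f = G.expect f := by
  simp [partialExpect, expect, prob]

lemma partialExpect_empty_one (G : BayesNet V) : G.partialExpect ∅ (fun _ => 1) = 1 := by
  simp [partialExpect]

lemma partialExpect_mul_const (G : BayesNet V) (U : Finset V) (f : (V → Bool) → ℝ) (a : ℝ) :
    G.partialExpect U (fun x => f x * a) = G.partialExpect U f * a := by
  simp only [partialExpect, ← mul_assoc, ← Finset.sum_mul]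

/-- Integrating out a node without children. -/
lemma partialExpect_insert (G : BayesNet V) {U : Finset V} {i : V} (hiU : i ∉ U)
    (hi : ∀ v ∈ U, i ∉ G.pa v) (f : (V → Bool) → ℝ) :
    G.partialExpect (insert i U) f = G.partialExpect U
      (fun x => ∑ b, G.cpt i (G.restrict i x) b * f (Function.update x i b)) := by
  -- One more uniform node gives an extra `1/2`, which cancels the `2` from `sum_sum_update_bool`.
  have hcard : (Uᶜ).card = ((insert i U)ᶜ).card + 1 := by
    rw [Finset.compl_insert, Finset.card_erase_add_one (by simpa using hiU)]
  have key := sum_sum_update_bool i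
    (fun x => (∏ v ∈ insert i U, G.cpt v (G.restrict v x) (x v)) * f x)
  have hpt : ∀ x : V → Bool,
      ∑ b, (∏ v ∈ insert i U, G.cpt v (G.restrict v (Function.update x i b))
        (Function.update x i b v)) * f (Function.update x i b)
      = (∏ v ∈ U, G.cpt v (G.restrict v x) (x v)) *
        ∑ b, G.cpt i (G.restrict i x) b * f (Function.update x i b) := by
    intro x
    rw [Finset.mul_sum]
    refine Finset.sum_congr rfl fun b _ => ?_
    have hprod : ∏ v ∈ U, G.cpt v (G.restrict v (Function.update x i b))
        (Function.update x i b v) = ∏ v ∈ U, G.cpt v (G.restrict v x) (x v) := by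
      refine Finset.prod_congr rfl fun v hv => ?_
      have : v ≠ i := fun e => hiU (e ▸ hv)
      rw [G.restrict_update_of_notMem (hi v hv), Function.update_of_ne this]
    rw [Finset.prod_insert hiU, hprod, G.restrict_update_of_notMem (G.notMem_pa_self i),
      Function.update_self]
    ring
  simp_rw [hpt] at key
  rw [partialExpect, partialExpect, key, hcard, pow_succ, mul_inv]
  ring

/-- The Fourier coefficient of `∏ v ∈ U, h v (x v)` at `S` with respect to `partialExpect`. -/
noncomputable def productCoeff (G : BayesNet V) (U : Finset V) (h : V → Bool → ℝ)
    (S : Finset V) : ℝ :=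
  G.partialExpect U fun x => (∏ v ∈ U, h v (x v)) * G.basis S x

lemma productCoeff_insert_of_notMem (G : BayesNet V) {U S : Finset V} {i : V} (hiU : i ∉ U)
    (hi : ∀ v ∈ U, i ∉ G.pa v) (hS : S ⊆ U) (h : V → Bool → ℝ) :
    G.productCoeff (insert i U) h S = G.partialExpect U fun x =>
      (∏ v ∈ U, h v (x v)) * G.basis S x * G.condMean i (h i) (G.restrict i x) := by
  rw [productCoeff, G.partialExpect_insert hiU hi]
  congr 1
  funext x
  rw [condMean, Finset.mul_sum]
  refine Finset.sum_congr rfl fun b _ => ?_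
  rw [G.basis_update_of_notMem (fun hiS => hiU (hS hiS)) (fun v hv => hi v (hS hv)),
    Finset.prod_insert hiU, Function.update_self,
    Finset.prod_congr rfl fun v hv => by
      rw [Function.update_of_ne (fun e : v = i => hiU (e ▸ hv))]]
  ring

lemma productCoeff_insert_insert (G : BayesNet V) {U S : Finset V} {i : V} (hiU : i ∉ U)
    (hi : ∀ v ∈ U, i ∉ G.pa v) (hS : S ⊆ U) (h : V → Bool → ℝ) :
    G.productCoeff (insert i U) h (insert i S) = G.partialExpect U fun x =>
      (∏ v ∈ U, h v (x v)) * G.basis S x * G.condCoeff i (h i) (G.restrict i x) := by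
  have hiS : i ∉ S := fun hiS => hiU (hS hiS)
  have hbasis : ∀ x, G.basis (insert i S) x =
      (bit (x i) - G.mean i (G.restrict i x)) / G.std i (G.restrict i x) * G.basis S x :=
    fun x => Finset.prod_insert hiS
  rw [productCoeff, G.partialExpect_insert hiU hi]
  congr 1
  funext x
  rw [condCoeff, Finset.mul_sum]
  refine Finset.sum_congr rfl fun b _ => ?_
  rw [hbasis, G.basis_update_of_notMem hiS (fun v hv => hi v (hS hv)),
    G.restrict_update_of_notMem (G.notMem_pa_self i),
    Finset.prod_insert hiU, Function.update_self,
    Finset.prod_congr rfl fun v hv => by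
      rw [Function.update_of_ne (fun e : v = i => hiU (e ▸ hv))]]
  ring

/-- A bound for products over `U` persists after multiplication by a function of the at most one
parent of a further node. -/
lemma sum_abs_partialExpect_mul_le (G : BayesNet V) (hG : G.IsForest) {t : ℝ} (ht : 0 ≤ t)
    {U : Finset V} {i : V} (hpa : G.pa i ⊆ U)
    (ih : ∀ h, ∑ S ∈ U.powerset, |G.productCoeff U h S| ≤ ∏ v ∈ U, bitNorm t (h v))
    (h : V → Bool → ℝ) (a : (G.pa i → Bool) → ℝ) :
    ∑ S ∈ U.powerset, |G.partialExpect U fun x =>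
      (∏ v ∈ U, h v (x v)) * G.basis S x * a (G.restrict i x)|
      ≤ (∏ v ∈ U, bitNorm t (h v)) * bitNorm t (fun b => a fun _ => b) := by
  have hU0 : 0 ≤ ∏ v ∈ U, bitNorm t (h v) :=
    Finset.prod_nonneg fun v _ => bitNorm_nonneg ht _
  rcases Nat.le_one_iff_eq_zero_or_eq_one.mp (hG i) with h0 | h1
  · have hempty := Finset.card_eq_zero.mp h0
    -- Without parents there is only one parent assignment, so `a` contributes a constant.
    have hr : ∀ x, G.restrict i x = fun _ => false := fun x => by
      funext u
      exact absurd u.2 (by simp [hempty])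
    simp_rw [hr, partialExpect_mul_const, abs_mul]
    rw [← Finset.sum_mul]
    refine mul_le_mul (ih h) ?_ (abs_nonneg _) hU0
    unfold bitNorm
    exact (le_max_left _ _).trans (le_add_of_nonneg_right (by positivity))
  · obtain ⟨p, hp⟩ := Finset.card_eq_one.mp h1
    have hpU : p ∈ U := hpa (by simp [hp])
    have hr : ∀ x, G.restrict i x = fun _ => x p := fun x => by
      funext u
      have hu : (u : V) = p := Finset.eq_of_mem_singleton (hp.le u.2)
      simp [restrict, hu]
    let k : Bool → ℝ := fun b => a fun _ => b
    -- The parent `p` lies in `U`, so its factor can absorb `k` and the product form is kept.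
    let h' : V → Bool → ℝ := Function.update h p (fun b => h p b * k b)
    have hne : ∀ v ∈ U.erase p, h' v = h v := fun v hv =>
      Function.update_of_ne (Finset.ne_of_mem_erase hv) _ _
    have hself : h' p = fun b => h p b * k b := Function.update_self _ _ _
    have hprod : ∀ x : V → Bool, ∏ v ∈ U, h' v (x v) = (∏ v ∈ U, h v (x v)) * k (x p) := by
      intro x
      rw [← Finset.mul_prod_erase U _ hpU, ← Finset.mul_prod_erase U (fun v => h v (x v)) hpU,
        Finset.prod_congr rfl fun v hv => by rw [hne v hv], hself]
      ring
    have hcoeff : ∀ S, (G.partialExpect U fun x =>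
        (∏ v ∈ U, h v (x v)) * G.basis S x * a (G.restrict i x)) = G.productCoeff U h' S := by
      intro S
      rw [productCoeff]
      congr 1
      funext x
      rw [hprod, hr]
      ring
    simp_rw [hcoeff]
    refine (ih h').trans ?_
    rw [← Finset.mul_prod_erase U _ hpU, ← Finset.mul_prod_erase U (fun v => bitNorm t (h v)) hpU,
      Finset.prod_congr rfl fun v hv => by rw [hne v hv], hself]
    have hrest : 0 ≤ ∏ v ∈ U.erase p, bitNorm t (h v) :=
      Finset.prod_nonneg fun v _ => bitNorm_nonneg ht _
    calc _ ≤ bitNorm t (h p) * bitNorm t k * ∏ v ∈ U.erase p, bitNorm t (h v) :=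
          mul_le_mul_of_nonneg_right (bitNorm_mul_le ht _ _) hrest
      _ = _ := by ring

/-- Induction on the size of a parent-closed `U`. The factors `h` stay universally quantified
because each step alters the parent's factor. -/
theorem sum_abs_productCoeff_le (G : BayesNet V) (hG : G.IsForest) {α t : ℝ}
    (hα : G.IsDifferenceBounded α) (ht : 0 ≤ t) (htα : 1 / 2 + 2 * α * t = t) (U : Finset V) :
    (∀ v ∈ U, G.pa v ⊆ U) → ∀ h : V → Bool → ℝ,
      ∑ S ∈ U.powerset, |G.productCoeff U h S| ≤ ∏ v ∈ U, bitNorm t (h v) := by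
  induction hn : U.card generalizing U with
  | zero =>
    intro _ h
    obtain rfl := Finset.card_eq_zero.mp hn
    simp [productCoeff, basis, partialExpect_empty_one]
  | succ n ihn =>
    intro hU h
    obtain ⟨i, hiU, hi⟩ := G.exists_childless (Finset.card_pos.mp (by omega : 0 < U.card))
    obtain ⟨W, hiW, rfl⟩ : ∃ W, i ∉ W ∧ insert i W = U :=
      ⟨U.erase i, Finset.notMem_erase i U, Finset.insert_erase hiU⟩
    have hiW' : ∀ v ∈ W, i ∉ G.pa v := fun v hv => hi v (Finset.mem_insert_of_mem hv)
    -- Removing a childless node preserves closure under parents.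
    have hcl : ∀ v ∈ insert i W, G.pa v ⊆ W := fun v hv u hu =>
      (Finset.mem_insert.mp (hU v hv hu)).resolve_left fun e => hi v hv (e ▸ hu)
    have ih := ihn W (by rw [Finset.card_insert_of_notMem hiW] at hn; omega)
      fun v hv => hcl v (Finset.mem_insert_of_mem hv)
    have hpa := hcl i (Finset.mem_insert_self i W)
    have hW0 : 0 ≤ ∏ v ∈ W, bitNorm t (h v) :=
      Finset.prod_nonneg fun v _ => bitNorm_nonneg ht _
    rw [Finset.sum_powerset_insert hiW, Finset.prod_insert hiW,
      Finset.sum_congr rfl fun S hS => by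
        rw [G.productCoeff_insert_of_notMem hiW hiW' (Finset.mem_powerset.mp hS)],
      Finset.sum_congr (s₁ := W.powerset) (f := fun S => |G.productCoeff _ h (insert i S)|) rfl
        fun S hS => by
        rw [G.productCoeff_insert_insert hiW hiW' (Finset.mem_powerset.mp hS)]]
    refine (add_le_add (G.sum_abs_partialExpect_mul_le hG ht hpa ih h _)
      (G.sum_abs_partialExpect_mul_le hG ht hpa ih h _)).trans ?_
    rw [← mul_add, mul_comm]
    exact mul_le_mul_of_nonneg_right
      (G.bitNorm_condMean_add_bitNorm_condCoeff_le hα ht htα i (h i)) hW0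

end BayesNet

/-! ### Conjunctions as products -/

/-- The factor of a conjunction at the variable `v`. -/
def literalFactor {V : Type*} [DecidableEq V] (T₁ T₀ : Finset V) (v : V) (b : Bool) : ℝ :=
  if (v ∈ T₁ → b = true) ∧ (v ∈ T₀ → b = false) then 1 else 0

lemma conjunction_eq_prod {V : Type*} [Fintype V] [DecidableEq V] (T₁ T₀ : Finset V)
    (x : V → Bool) : conjunction T₁ T₀ x = ∏ v, literalFactor T₁ T₀ v (x v) := by
  unfold conjunction literalFactor
  rw [Finset.prod_ite_zero]
  simp [forall_and]

lemma bitNorm_literalFactor {V : Type*} [DecidableEq V] {T₁ T₀ : Finset V}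
    (hT : Disjoint T₁ T₀) (t : ℝ) (v : V) :
    bitNorm t (literalFactor T₁ T₀ v) = if v ∈ T₁ ∪ T₀ then 1 + t else 1 := by
  by_cases h1 : v ∈ T₁
  · have h0 : v ∉ T₀ := Finset.disjoint_left.mp hT h1
    simp [bitNorm, literalFactor, h1, h0]
  · by_cases h0 : v ∈ T₀ <;> simp [bitNorm, literalFactor, h1, h0]

theorem mainTheorem1 {V : Type*} [Fintype V] [DecidableEq V]
    (G : BayesNet V) (hG : G.IsForest)
    (c : ℝ) (hc0 : 0 < c) (hc1 : c < 1) (hc : G.IsBounded c)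
    (α : ℝ) (hα : α < 1 / 2) (hdiff : G.IsDifferenceBounded α)
    (T₁ T₀ : Finset V) (hT : Disjoint T₁ T₀)
    (d : ℕ) (hd : T₁.card + T₀.card = d) :
    G.spectralNorm (conjunction T₁ T₀) ≤ ((2 - 2 * α) / (1 - 2 * α)) ^ (2 * d) := by
  have hpos : 0 < 1 - 2 * α := by linarith
  -- The solution of `1/2 + 2αt = t`, nonnegative because `α < 1/2`.
  set t : ℝ := 1 / (2 * (1 - 2 * α)) with ht_def
  have ht : 0 ≤ t := by positivity
  have htα : 1 / 2 + 2 * α * t = t := by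
    rw [ht_def]
    field_simp
    ring
  have hbase : (2 - 2 * α) / (1 - 2 * α) = 1 + 2 * t := by
    rw [ht_def]
    field_simp
    ring
  have hmain := G.sum_abs_productCoeff_le hG hdiff ht htα Finset.univ
    (fun v _ => Finset.subset_univ _) (literalFactor T₁ T₀)
  have hnorm : G.spectralNorm (conjunction T₁ T₀) = ∑ S ∈ Finset.univ.powerset,
      |G.productCoeff Finset.univ (literalFactor T₁ T₀) S| := by
    simp only [BayesNet.spectralNorm, BayesNet.fourierCoeff, BayesNet.productCoeff,
      BayesNet.partialExpect_univ, conjunction_eq_prod, Finset.powerset_univ]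
  have hprod : ∏ v, bitNorm t (literalFactor T₁ T₀ v) = (1 + t) ^ d := by
    simp_rw [bitNorm_literalFactor hT]
    rw [Finset.prod_ite_mem, Finset.univ_inter, Finset.prod_const,
      Finset.card_union_of_disjoint hT, hd]
  rw [hnorm, hbase, pow_mul]
  -- It remains to compare bases: `1 + t ≤ (1 + 2t)²`.
  refine (hmain.trans_eq hprod).trans (pow_le_pow_left₀ (by linarith) ?_ d)
  nlinarith
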